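/- Let $\Psi:[0,\infty)\to\mathbb{R}$ be continuous and increasing with $\Psi(0)=0$, and continuously differentiable with $\Psi'(t)\neq 0$ on $(0,\infty)$. Let $0<\mu<1$, let $A$ be a constant real $n\times n$ matrix, $\boldsymbol\eta\in\mathbb{R}^n$ and $\boldsymbol g:[0,\infty)\to\mathbb{R}^n$. For a real function $f$ on $[0,\infty)$ the $\Psi$-Caputo derivative of order $\mu$ is $$ {}^{C}D^{\mu}_{\Psi}f(t)=\frac{1}{\Gamma(1-\mu)}\int_0^t\big(\Psi(t)-\Psi(s)\big)^{-\mu}\,\Psi'(s)\,\Big(\frac{1}{\Psi'(s)}f'(s)\Big)\,\mathrm{d}s ; $$ for vector functions it is taken componentwise. A function $\boldsymbol f:[0,\infty)\to\mathbb{R}^n$ is called $\Psi$-exponentially bounded if there are constants $c,M,T>0$ with $\|\boldsymbol f(t)\|_\infty\le M e^{c\Psi(t)}$ for all $t>T$. Consider the initial value problem $$ {}^{C}D^{\mu}_{\Psi}\boldsymbol y(t)=A\boldsymbol y(t)+\boldsymbol g(t)\quad(t>0),\qquad \boldsymbol y(0)=\boldsymbol\eta .$$ By a continuous solution we mean a continuous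 function $\boldsymbol y:[0,\infty)\to\mathbb{R}^n$, absolutely continuous on each interval $[0,T]$ (for instance a $C^1$ function), such that the integral defining ${}^{C}D^{\mu}_{\Psi}\boldsymbol y(t)$ converges absolutely and the equation holds for every $t>0$, and $\boldsymbol y(0)=\boldsymbol\eta$. Suppose that $\boldsymbol g$ is continuous on $[0,\infty)$ and $\Psi$-exponentially bounded. Then for every continuous solution $\boldsymbol y$ of the initial value problem (in particular for the unique one, when the problem is assumed to be uniquely solvable), both $\boldsymbol y$ and ${}^{C}D^{\mu}_{\Psi}\boldsymbol y$ are $\Psi$-exponentially bounded. -/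

import Mathlib

/-- The operator `(1 / Ψ'(t)) · d/dt`. -/
noncomputable def psiDeriv (Ψ f : ℝ → ℝ) (t : ℝ) : ℝ :=
  1 / deriv Ψ t * deriv f t

/-- The integrand `s ↦ (Ψ(t) - Ψ(s)) ^ (μ - 1) Ψ'(s) f(s)` of the Riemann–Liouville
fractional integral of order `μ` with respect to `Ψ`. -/
noncomputable def psiIntegrand (μ : ℝ) (Ψ f : ℝ → ℝ) (t s : ℝ) : ℝ :=
  (Ψ t - Ψ s) ^ (μ - 1) * deriv Ψ s * f s

/-- The Riemann–Liouville fractional integral with respect to `Ψ`, of order `μ`, based at `a`. -/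
noncomputable def psiIntegral (a μ : ℝ) (Ψ f : ℝ → ℝ) (t : ℝ) : ℝ :=
  1 / Real.Gamma μ * ∫ s in a..t, psiIntegrand μ Ψ f t s

/-- The Caputo fractional derivative with respect to `Ψ`, of order `μ`, based at `a`:
`I^{m - μ} ((1 / Ψ') d/dt)^m f` with `m = ⌊μ⌋ + 1` (so `m = 1` when `0 < μ < 1`). -/
noncomputable def psiCaputo (a μ : ℝ) (Ψ f : ℝ → ℝ) (t : ℝ) : ℝ :=
  psiIntegral a (((⌊μ⌋₊ + 1 : ℕ) : ℝ) - μ) Ψ ((psiDeriv Ψ)^[⌊μ⌋₊ + 1] f) t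

/-- The integral that defines the `Ψ`-Caputo derivative of `f` at `t` converges (absolutely). -/
def PsiCaputoExists (a μ : ℝ) (Ψ f : ℝ → ℝ) (t : ℝ) : Prop :=
  IntervalIntegrable
    (psiIntegrand (((⌊μ⌋₊ + 1 : ℕ) : ℝ) - μ) Ψ ((psiDeriv Ψ)^[⌊μ⌋₊ + 1] f) t)
    MeasureTheory.volume a t

/-- `f : [0, ∞) → ℝⁿ` is of `Ψ`-exponential order `c`. The norm on `Fin n → ℝ` is the
maximum norm. -/
def PsiExpOrder {n : ℕ} (Ψ : ℝ → ℝ) (f : ℝ → Fin n → ℝ) (c : ℝ) : Prop :=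
  ∃ M T : ℝ, 0 < M ∧ 0 < T ∧ ∀ t, T < t → ‖f t‖ ≤ M * Real.exp (c * Ψ t)

/-- `f` is `Ψ`-exponentially bounded: it is of `Ψ`-exponential order `c` for some `c > 0`. -/
def PsiExpBounded {n : ℕ} (Ψ : ℝ → ℝ) (f : ℝ → Fin n → ℝ) : Prop :=
  ∃ c : ℝ, 0 < c ∧ PsiExpOrder Ψ f c

/-- The function `Ψ` on `[0, ∞)`: continuous and increasing with `Ψ(0) = 0` (hence
nonnegative), and continuously differentiable with nonvanishing derivative on `(0, ∞)`. Nothing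
is asked of `Ψ'` at `0`, so that `Ψ(t) = √t` and `Ψ(t) = t²` are allowed besides the functions
that are `C¹` with nonvanishing derivative on all of `[0, ∞)`. -/
structure IsPsi (Ψ : ℝ → ℝ) : Prop where
  zero : Ψ 0 = 0
  mono : MonotoneOn Ψ (Set.Ici 0)
  cont : ContinuousOn Ψ (Set.Ici 0)
  contDiff : ContDiffOn ℝ 1 Ψ (Set.Ioi 0)
  deriv_ne : ∀ t, 0 < t → deriv Ψ t ≠ 0

/-- `y` is a continuous solution on `[0, ∞)` of the system `ᶜD^μ y = A y + g`, `y(0) = η`.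
The `Ψ`-Caputo derivative acts on each component; it involves the first derivative of `y`, so
`y` is required to be absolutely continuous on every `[0, T]` (which holds if `y` is `C¹`).
The differential equation is imposed at every `t > 0`; at `t = 0` the integral that defines the
Caputo derivative is over a point. -/
structure IsPsiCaputoSolution {n : ℕ} (μ : ℝ) (Ψ : ℝ → ℝ) (A : Matrix (Fin n) (Fin n) ℝ)
    (g : ℝ → Fin n → ℝ) (η : Fin n → ℝ) (y : ℝ → Fin n → ℝ) : Prop where
  cont : ContinuousOn y (Set.Ici 0)
  absCont : ∀ T, 0 < T → ∀ i, AbsolutelyContinuousOnInterval (fun t => y t i) 0 T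
  caputoExists : ∀ t, 0 < t → ∀ i, PsiCaputoExists 0 μ Ψ (fun s => y s i) t
  equation : ∀ t, 0 < t → ∀ i,
    psiCaputo 0 μ Ψ (fun s => y s i) t = (A.mulVec (y t) + g t) i
  init : y 0 = η

open MeasureTheory Set Real

/-! Applying the fractional integral of order `μ` to the equation turns it into the Volterra
equation `y - η = I^μ (A y + g)` (`setIntegral_mul_psiCaputo`). In the norm weighted by `exp (-c
Ψ)`, the operator `I^μ` has norm at most `c ^ (-μ)` (`abs_sub_le_of_abs_psiCaputo_le`). For large
`c` the term `I^μ (A y)` is therefore absorbed into the left side, which bounds the weighted maximum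
of `y` on `[0, t]` independently of `t` (`IsPsiCaputoSolution.norm_le`). No Gronwall inequality or
Mittag-Leffler function is needed. The bound for the derivative is then read off the equation. -/

/-! ### Integrals of the power kernels -/

/-- The Beta integral `∫ₐᵇ (b - u) ^ (μ - 1) (u - a) ^ (-μ) du` does not depend on `a < b`. -/
theorem intervalIntegral_sub_rpow_mul_sub_rpow {μ a b : ℝ} (hμ0 : 0 < μ) (hμ1 : μ < 1)
    (hab : a < b) :
    ∫ u in a..b, (b - u) ^ (μ - 1) * (u - a) ^ (-μ) = Gamma μ * Gamma (1 - μ) := by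
  have hL : 0 < b - a := sub_pos.2 hab
  have h0 : ∫ u in a..b, (b - u) ^ (μ - 1) * (u - a) ^ (-μ)
      = ∫ x in (0 : ℝ)..(b - a), x ^ (-μ) * ((b - a) - x) ^ (μ - 1) := by
    have := intervalIntegral.integral_comp_sub_right (a := a) (b := b)
      (fun x : ℝ => x ^ (-μ) * ((b - a) - x) ^ (μ - 1)) a
    rw [sub_self] at this
    rw [← this]
    refine intervalIntegral.integral_congr fun u _ => ?_
    simp only [sub_sub_sub_cancel_right]
    exact mul_comm _ _
  have h1 := Complex.betaIntegral_scaled ((1 - μ : ℝ) : ℂ) (μ : ℂ) hL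
  have h2 := Complex.Gamma_mul_Gamma_eq_betaIntegral (s := ((1 - μ : ℝ) : ℂ)) (t := (μ : ℂ))
    (by simpa using hμ1) (by simpa using hμ0)
  -- The Beta parameters sum to `1`, so the scaling factor is `(b - a) ^ 0`.
  have e1 : ((1 - μ : ℝ) : ℂ) + (μ : ℂ) = 1 := by push_cast; ring
  rw [e1, Complex.Gamma_one, one_mul, Complex.Gamma_ofReal, Complex.Gamma_ofReal] at h2
  rw [e1, sub_self, Complex.cpow_zero, one_mul, ← h2] at h1
  rw [h0]
  have h3 : ∫ x in (0 : ℝ)..(b - a), (x : ℂ) ^ (((1 - μ : ℝ) : ℂ) - 1)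
        * (((b - a : ℝ) : ℂ) - x) ^ ((μ : ℂ) - 1)
      = ∫ x in (0 : ℝ)..(b - a), ((x ^ (-μ) * ((b - a) - x) ^ (μ - 1) : ℝ) : ℂ) := by
    refine intervalIntegral.integral_congr fun x hx => ?_
    rw [uIcc_of_le hL.le] at hx
    have e2 : ((1 - μ : ℝ) : ℂ) - 1 = ((-μ : ℝ) : ℂ) := by push_cast; ring
    have e3 : (μ : ℂ) - 1 = ((μ - 1 : ℝ) : ℂ) := by push_cast; ring
    simp only [e2, e3]
    rw [Complex.ofReal_mul, Complex.ofReal_cpow hx.1, Complex.ofReal_cpow (sub_nonneg.2 hx.2),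
      Complex.ofReal_sub (b - a) x]
  rw [h3, intervalIntegral.integral_ofReal] at h1
  rw [mul_comm (Gamma μ)]
  exact_mod_cast h1

/-- Substituting `v = b - u` and enlarging the range to `(0, ∞)` gives a Gamma integral. The factor
`c ^ (-μ)` is the smallness used for absorption. -/
theorem integrableOn_sub_rpow_mul_exp {μ c : ℝ} (hμ : 0 < μ) (hc : 0 < c) {a b : ℝ}
    (hab : a ≤ b) :
    IntegrableOn (fun u => (b - u) ^ (μ - 1) * exp (c * u)) (Icc a b) ∧
      ∫ u in Icc a b, (b - u) ^ (μ - 1) * exp (c * u) ≤ Gamma μ * c ^ (-μ) * exp (c * b) := by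
  have hI : IntegrableOn (fun v : ℝ => v ^ (μ - 1) * exp (-(c * v))) (Ioi 0) := by
    have := integrableOn_rpow_mul_exp_neg_mul_rpow (p := 1) (s := μ - 1) (b := c)
      (by linarith) one_pos hc
    simpa using this
  have hv := integral_rpow_mul_exp_neg_mul_Ioi hμ hc
  have hfun : ∀ u, (b - u) ^ (μ - 1) * exp (c * u)
      = exp (c * b) * ((b - u) ^ (μ - 1) * exp (-(c * (b - u)))) := fun u => by
    have : exp (c * u) = exp (c * b) * exp (-(c * (b - u))) := by rw [← exp_add]; ring_nf
    rw [this]; ring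
  have hint : IntervalIntegrable (fun v : ℝ => v ^ (μ - 1) * exp (-(c * v))) volume 0 (b - a) := by
    rw [intervalIntegrable_iff_integrableOn_Ioc_of_le (sub_nonneg.2 hab)]
    exact hI.mono_set Ioc_subset_Ioi_self
  have hint' := (hint.comp_sub_left b).symm
  simp only [sub_sub_cancel, sub_zero] at hint'
  rw [intervalIntegrable_iff_integrableOn_Icc_of_le hab] at hint'
  simp only [hfun]
  refine ⟨hint'.const_mul _, ?_⟩
  rw [integral_const_mul, mul_comm (_ * _) (exp _)]
  refine mul_le_mul_of_nonneg_left ?_ (exp_pos _).le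
  have h1 := intervalIntegral.integral_comp_sub_left (a := a) (b := b)
    (fun v : ℝ => v ^ (μ - 1) * exp (-(c * v))) b
  rw [integral_Icc_eq_integral_Ioc, ← intervalIntegral.integral_of_le hab, h1, sub_self,
    intervalIntegral.integral_of_le (sub_nonneg.2 hab)]
  calc _ ≤ ∫ v in Ioi (0 : ℝ), v ^ (μ - 1) * exp (-(c * v)) := by
        refine setIntegral_mono_set hI ?_ Ioc_subset_Ioi_self.eventuallyLE
        filter_upwards [ae_restrict_mem measurableSet_Ioi] with v hv
        exact mul_nonneg (rpow_nonneg (le_of_lt hv) _) (exp_pos _).le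
    _ = _ := by
        rw [hv, one_div, inv_rpow hc.le, rpow_neg hc.le, mul_comm]

/-! ### Substitution by `Ψ` -/

namespace IsPsi

variable {Ψ : ℝ → ℝ}

theorem hasDerivAt (hΨ : IsPsi Ψ) {t : ℝ} (ht : 0 < t) : HasDerivAt Ψ (deriv Ψ t) t :=
  ((hΨ.contDiff.differentiableOn one_ne_zero).differentiableAt (Ioi_mem_nhds ht)).hasDerivAt

theorem deriv_pos (hΨ : IsPsi Ψ) {t : ℝ} (ht : 0 < t) : 0 < deriv Ψ t := by
  refine lt_of_le_of_ne ?_ (hΨ.deriv_ne t ht).symm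
  have h := (hΨ.mono.mono Ioi_subset_Ici_self).derivWithin_nonneg (x := t)
  rwa [derivWithin_of_isOpen isOpen_Ioi ht] at h

theorem nonneg (hΨ : IsPsi Ψ) {t : ℝ} (ht : 0 ≤ t) : 0 ≤ Ψ t :=
  hΨ.zero ▸ hΨ.mono self_mem_Ici ht ht

theorem strictMonoOn (hΨ : IsPsi Ψ) : StrictMonoOn Ψ (Ici 0) := by
  refine strictMonoOn_of_deriv_pos (convex_Ici 0) hΨ.cont fun t ht => hΨ.deriv_pos ?_
  simpa using ht

theorem continuousOn_Icc (hΨ : IsPsi Ψ) {r : ℝ} (hr : 0 ≤ r) (t : ℝ) :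
    ContinuousOn Ψ (Icc r t) :=
  hΨ.cont.mono fun _ hx => hr.trans hx.1

theorem setIntegral_comp (hΨ : IsPsi Ψ) {r t : ℝ} (hr : 0 ≤ r) (hrt : r ≤ t) (G : ℝ → ℝ) :
    ∫ s in Ioo r t, deriv Ψ s * G (Ψ s) = ∫ u in Icc (Ψ r) (Ψ t), G u := by
  rw [← integral_Icc_eq_integral_Ioo]
  exact integral_Icc_deriv_smul_of_deriv_nonneg (hΨ.continuousOn_Icc hr t)
    (fun _ hx => hΨ.hasDerivAt (hr.trans_lt hx.1))
    (fun _ hx => (hΨ.deriv_pos (hr.trans_lt hx.1)).le) hrt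

theorem integrableOn_comp (hΨ : IsPsi Ψ) {r t : ℝ} (hr : 0 ≤ r) (hrt : r ≤ t) {G : ℝ → ℝ}
    (hG : IntegrableOn G (Icc (Ψ r) (Ψ t))) :
    IntegrableOn (fun s => deriv Ψ s * G (Ψ s)) (Ioo r t) :=
  ((integrableOn_Icc_deriv_smul_iff_of_deriv_nonneg (hΨ.continuousOn_Icc hr t)
    (fun _ hx => hΨ.hasDerivAt (hr.trans_lt hx.1))
    (fun _ hx => (hΨ.deriv_pos (hr.trans_lt hx.1)).le) hrt).2 hG).mono_set Ioo_subset_Icc_self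

theorem setIntegral_kernel (hΨ : IsPsi Ψ) {μ r t : ℝ} (hμ0 : 0 < μ) (hμ1 : μ < 1)
    (hr : 0 ≤ r) (hrt : r < t) :
    ∫ s in Ioo r t, (Ψ t - Ψ s) ^ (μ - 1) * deriv Ψ s * (Ψ s - Ψ r) ^ (-μ)
      = Gamma μ * Gamma (1 - μ) := by
  have hlt := hΨ.strictMonoOn hr (hr.trans hrt.le) hrt
  have h := hΨ.setIntegral_comp hr hrt.le (fun u => (Ψ t - u) ^ (μ - 1) * (u - Ψ r) ^ (-μ))
  rw [integral_Icc_eq_integral_Ioc, ← intervalIntegral.integral_of_le hlt.le,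
    intervalIntegral_sub_rpow_mul_sub_rpow hμ0 hμ1 hlt] at h
  rw [← h]
  exact integral_congr_ae (Filter.Eventually.of_forall fun s => by ring)

theorem integrableOn_kernel (hΨ : IsPsi Ψ) {μ r t : ℝ} (hμ0 : 0 < μ) (hμ1 : μ < 1)
    (hr : 0 ≤ r) (hrt : r < t) :
    IntegrableOn (fun s => (Ψ t - Ψ s) ^ (μ - 1) * deriv Ψ s * (Ψ s - Ψ r) ^ (-μ))
      (Ioo r t) := by
  -- The Bochner integral of a non-integrable function is `0`, so the nonzero Beta value already
  -- gives integrability.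
  refine Integrable.of_integral_ne_zero ?_
  rw [hΨ.setIntegral_kernel hμ0 hμ1 hr hrt]
  exact (mul_pos (Gamma_pos_of_pos hμ0) (Gamma_pos_of_pos (sub_pos.2 hμ1))).ne'

theorem kernel_nonneg (hΨ : IsPsi Ψ) {μ r s t : ℝ} (hr : 0 ≤ r) (hrs : r < s) (hst : s < t) :
    0 ≤ (Ψ t - Ψ s) ^ (μ - 1) * deriv Ψ s * (Ψ s - Ψ r) ^ (-μ) := by
  have hs : 0 < s := hr.trans_lt hrs
  exact mul_nonneg (mul_nonneg (rpow_nonneg (sub_nonneg.2 (hΨ.mono hs.le (hs.trans hst).le hst.le))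
    _) (hΨ.deriv_pos hs).le) (rpow_nonneg (sub_nonneg.2 (hΨ.mono hr hs.le hrs.le)) _)

end IsPsi

/-! ### The fractional integral of the Caputo derivative -/

theorem psiCaputo_eq_setIntegral {μ : ℝ} (hμ1 : μ < 1) {Ψ : ℝ → ℝ} (hΨ : IsPsi Ψ)
    (f : ℝ → ℝ) {s : ℝ} (hs : 0 ≤ s) :
    psiCaputo 0 μ Ψ f s
      = 1 / Gamma (1 - μ) * ∫ r in Ioo 0 s, (Ψ s - Ψ r) ^ (-μ) * deriv f r := by
  have hfl : ⌊μ⌋₊ = 0 := Nat.floor_eq_zero.2 hμ1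
  unfold psiCaputo psiIntegral
  rw [hfl]
  simp only [zero_add, Nat.cast_one, Function.iterate_one]
  rw [intervalIntegral.integral_of_le hs, integral_Ioc_eq_integral_Ioo]
  congr 1
  refine setIntegral_congr_fun measurableSet_Ioo fun r hr => ?_
  have := hΨ.deriv_ne r hr.1
  simp only [psiIntegrand, psiDeriv]
  rw [show 1 - μ - 1 = -μ by ring]
  field_simp

/-- Justifies Fubini on the triangle `r < s`: for fixed `r`, the kernel is nonnegative with the same
Beta integral in `s`, so integrating absolute values leaves a constant times `|v r|`. -/
theorem integrable_iterated_kernel {μ : ℝ} (hμ0 : 0 < μ) (hμ1 : μ < 1) {Ψ : ℝ → ℝ}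
    (hΨ : IsPsi Ψ) {t : ℝ} {v : ℝ → ℝ} (hvm : Measurable v) (hv : IntegrableOn v (Ioo 0 t)) :
    Integrable (Function.uncurry fun s r => (Ioi r).indicator
        (fun s => (Ψ t - Ψ s) ^ (μ - 1) * deriv Ψ s * (Ψ s - Ψ r) ^ (-μ)) s * v r)
      ((volume.restrict (Ioo 0 t)).prod (volume.restrict (Ioo 0 t))) := by
  have hmeas : AEStronglyMeasurable (Function.uncurry fun s r => (Ioi r).indicator
        (fun s => (Ψ t - Ψ s) ^ (μ - 1) * deriv Ψ s * (Ψ s - Ψ r) ^ (-μ)) s * v r)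
      ((volume.restrict (Ioo 0 t)).prod (volume.restrict (Ioo 0 t))) := by
    -- `Ψ` is controlled only on `[0, ∞)`; this extension is continuous on the line and agrees with
    -- `Ψ` on the square.
    have hP : Continuous fun s => Ψ (max s 0) :=
      hΨ.cont.comp_continuous (by fun_prop) fun s => mem_Ici.2 (le_max_right _ _)
    have hm : Measurable fun p : ℝ × ℝ => {p : ℝ × ℝ | p.2 < p.1}.indicator
        (fun p => (Ψ t - Ψ (max p.1 0)) ^ (μ - 1) * deriv Ψ p.1
          * (Ψ (max p.1 0) - Ψ (max p.2 0)) ^ (-μ)) p * v p.2 := by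
      have h1 : Measurable fun p : ℝ × ℝ => Ψ (max p.1 0) := hP.measurable.comp measurable_fst
      have h2 : Measurable fun p : ℝ × ℝ => Ψ (max p.2 0) := hP.measurable.comp measurable_snd
      have h3 : Measurable fun p : ℝ × ℝ => deriv Ψ p.1 :=
        (measurable_deriv Ψ).comp measurable_fst
      refine Measurable.mul (Measurable.indicator ?_ (measurableSet_lt measurable_snd
        measurable_fst)) (hvm.comp measurable_snd)
      exact ((((measurable_const.sub h1).pow_const _).mul h3).mul ((h1.sub h2).pow_const _))
    refine hm.aestronglyMeasurable.congr ?_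
    rw [Measure.prod_restrict]
    filter_upwards [ae_restrict_mem (measurableSet_Ioo.prod measurableSet_Ioo)] with p hp
    simp only [Function.uncurry, indicator, mem_ofPred_eq, mem_Ioi, max_eq_left hp.1.1.le,
      max_eq_left hp.2.1.le]
  have hset : ∀ r ∈ Ioo 0 t, Ioo 0 t ∩ Ioi r = Ioo r t := fun r hr => by
    ext s
    simp only [mem_inter_iff, mem_Ioo, mem_Ioi]
    exact ⟨fun h => ⟨h.2, h.1.2⟩, fun h => ⟨⟨hr.1.trans h.1, h.2⟩, h.1⟩⟩
  rw [integrable_prod_iff' hmeas]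
  constructor
  · filter_upwards [ae_restrict_mem measurableSet_Ioo] with r hr
    simp only [Function.uncurry]
    refine Integrable.mul_const ?_ _
    rw [integrable_indicator_iff measurableSet_Ioi, IntegrableOn,
      Measure.restrict_restrict measurableSet_Ioi, inter_comm, hset r hr]
    exact hΨ.integrableOn_kernel hμ0 hμ1 hr.1.le hr.2
  · refine (hv.norm.const_mul (Gamma μ * Gamma (1 - μ))).congr ?_
    filter_upwards [ae_restrict_mem measurableSet_Ioo] with r hr
    simp only [Function.uncurry, norm_mul, integral_mul_const, norm_indicator_eq_indicator_norm]
    rw [setIntegral_indicator measurableSet_Ioi, hset r hr,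
      ← hΨ.setIntegral_kernel hμ0 hμ1 hr.1.le hr.2]
    congr 1
    refine setIntegral_congr_fun measurableSet_Ioo fun s hs => ?_
    have := norm_of_nonneg (hΨ.kernel_nonneg (μ := μ) hr.1.le hs.1 hs.2)
    simpa only [norm_mul] using this.symm

/-- The fractional integral inverts the Caputo derivative up to the initial value. -/
theorem setIntegral_mul_psiCaputo {μ : ℝ} (hμ0 : 0 < μ) (hμ1 : μ < 1) {Ψ : ℝ → ℝ}
    (hΨ : IsPsi Ψ) {f : ℝ → ℝ} {t : ℝ} (ht : 0 < t)
    (hf : AbsolutelyContinuousOnInterval f 0 t) :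
    ∫ s in Ioo 0 t, (Ψ t - Ψ s) ^ (μ - 1) * deriv Ψ s * psiCaputo 0 μ Ψ f s
      = Gamma μ * (f t - f 0) := by
  have hΓ : Gamma (1 - μ) ≠ 0 := (Gamma_pos_of_pos (sub_pos.2 hμ1)).ne'
  have hv : IntegrableOn (deriv f) (Ioo 0 t) :=
    ((intervalIntegrable_iff_integrableOn_Ioc_of_le ht.le).1 hf.intervalIntegrable_deriv).mono_set
      Ioo_subset_Ioc_self
  have hswap := integral_integral_swap
    (integrable_iterated_kernel hμ0 hμ1 hΨ (measurable_deriv f) hv)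
  have hL : ∀ s ∈ Ioo 0 t, ∫ r in Ioo 0 t, (Ioi r).indicator
        (fun s => (Ψ t - Ψ s) ^ (μ - 1) * deriv Ψ s * (Ψ s - Ψ r) ^ (-μ)) s * deriv f r
      = Gamma (1 - μ) * ((Ψ t - Ψ s) ^ (μ - 1) * deriv Ψ s * psiCaputo 0 μ Ψ f s) := by
    intro s hs
    have h1 : ∀ r, (Ioi r).indicator
        (fun s => (Ψ t - Ψ s) ^ (μ - 1) * deriv Ψ s * (Ψ s - Ψ r) ^ (-μ)) s * deriv f r
        = (Iio s).indicator (fun r => (Ψ t - Ψ s) ^ (μ - 1) * deriv Ψ s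
          * ((Ψ s - Ψ r) ^ (-μ) * deriv f r)) r := fun r => by
      by_cases h : r < s <;> simp [indicator, h, mul_assoc]
    have hset : Ioo 0 t ∩ Iio s = Ioo 0 s := by
      ext r
      simp only [mem_inter_iff, mem_Ioo, mem_Iio]
      exact ⟨fun h => ⟨h.1.1, h.2⟩, fun h => ⟨⟨h.1, h.2.trans hs.2⟩, h.2⟩⟩
    simp only [h1]
    rw [setIntegral_indicator measurableSet_Iio, hset, integral_const_mul,
      psiCaputo_eq_setIntegral hμ1 hΨ f hs.1.le]
    field_simp
  have hR : ∀ r ∈ Ioo 0 t, ∫ s in Ioo 0 t, (Ioi r).indicator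
        (fun s => (Ψ t - Ψ s) ^ (μ - 1) * deriv Ψ s * (Ψ s - Ψ r) ^ (-μ)) s * deriv f r
      = Gamma μ * Gamma (1 - μ) * deriv f r := by
    intro r hr
    have hset : Ioo 0 t ∩ Ioi r = Ioo r t := by
      ext s
      simp only [mem_inter_iff, mem_Ioo, mem_Ioi]
      exact ⟨fun h => ⟨h.2, h.1.2⟩, fun h => ⟨⟨hr.1.trans h.1, h.2⟩, h.1⟩⟩
    rw [integral_mul_const, setIntegral_indicator measurableSet_Ioi, hset,
      hΨ.setIntegral_kernel hμ0 hμ1 hr.1.le hr.2]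
  -- After the swap only a constant times `∫ f'` remains, and absolute continuity evaluates it.
  rw [setIntegral_congr_fun measurableSet_Ioo hL, setIntegral_congr_fun measurableSet_Ioo hR,
    integral_const_mul, integral_const_mul, ← integral_Ioc_eq_integral_Ioo (f := deriv f),
    ← intervalIntegral.integral_of_le ht.le, hf.integral_deriv_eq_sub] at hswap
  apply mul_left_cancel₀ hΓ
  rw [hswap]
  ring

theorem abs_sub_le_of_abs_psiCaputo_le {μ : ℝ} (hμ0 : 0 < μ) (hμ1 : μ < 1) {Ψ : ℝ → ℝ}
    (hΨ : IsPsi Ψ) {f : ℝ → ℝ} {t : ℝ} (ht : 0 < t)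
    (hf : AbsolutelyContinuousOnInterval f 0 t) {c K : ℝ} (hc : 0 < c) (hK : 0 ≤ K)
    (hb : ∀ s ∈ Ioo 0 t, |psiCaputo 0 μ Ψ f s| ≤ K * exp (c * Ψ s)) :
    |f t - f 0| ≤ K * c ^ (-μ) * exp (c * Ψ t) := by
  have hΓ : 0 < Gamma μ := Gamma_pos_of_pos hμ0
  obtain ⟨hi, hle⟩ := integrableOn_sub_rpow_mul_exp hμ0 hc (hΨ.mono self_mem_Ici ht.le ht.le)
  have hi' := (hΨ.integrableOn_comp le_rfl ht.le hi).const_mul K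
  have h := norm_integral_le_of_norm_le
    (f := fun s => (Ψ t - Ψ s) ^ (μ - 1) * deriv Ψ s * psiCaputo 0 μ Ψ f s) hi' (by
      filter_upwards [ae_restrict_mem measurableSet_Ioo] with s hs
      have h1 : 0 ≤ (Ψ t - Ψ s) ^ (μ - 1) * deriv Ψ s :=
        mul_nonneg (rpow_nonneg (sub_nonneg.2 (hΨ.mono hs.1.le ht.le hs.2.le)) _)
          (hΨ.deriv_pos hs.1).le
      rw [norm_mul, norm_of_nonneg h1]
      refine (mul_le_mul_of_nonneg_left (hb s hs) h1).trans_eq ?_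
      ring)
  rw [setIntegral_mul_psiCaputo hμ0 hμ1 hΨ ht hf, integral_const_mul,
    hΨ.setIntegral_comp le_rfl ht.le (fun u => (Ψ t - u) ^ (μ - 1) * exp (c * u)),
    norm_mul, norm_of_nonneg hΓ.le, norm_eq_abs] at h
  refine le_of_mul_le_mul_left ((h.trans (mul_le_mul_of_nonneg_left hle hK)).trans_eq ?_) hΓ
  ring

/-! ### Exponential bounds -/

/-- One constant `G` serves every `c ≥ c₀`, so `c` can later be enlarged without changing `G`. -/
theorem exists_norm_le_mul_exp_of_psiExpBounded {n : ℕ} {Ψ : ℝ → ℝ} (hΨ : IsPsi Ψ)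
    {g : ℝ → Fin n → ℝ} (hg : ContinuousOn g (Ici 0)) (hgb : PsiExpBounded Ψ g) :
    ∃ c₀ G : ℝ, 0 < c₀ ∧ 0 ≤ G ∧ ∀ c, c₀ ≤ c → ∀ t, 0 ≤ t → ‖g t‖ ≤ G * exp (c * Ψ t) := by
  obtain ⟨c₀, hc₀, M, T, hM, -, hb⟩ := hgb
  obtain ⟨N, hN⟩ := (isCompact_Icc (a := (0 : ℝ)) (b := T)).exists_bound_of_continuousOn
    (hg.mono fun _ hx => hx.1)
  refine ⟨c₀, max M N, hc₀, hM.le.trans (le_max_left _ _), fun c hc t ht => ?_⟩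
  have hpos := hΨ.nonneg ht
  have hG : 0 ≤ max M N := hM.le.trans (le_max_left _ _)
  rcases le_or_gt t T with h | h
  · refine (hN t ⟨ht, h⟩).trans ((le_max_right M N).trans (le_mul_of_one_le_right hG ?_))
    exact one_le_exp (mul_nonneg (hc₀.le.trans hc) hpos)
  · refine (hb t h).trans (mul_le_mul (le_max_left _ _) ?_ (exp_pos _).le hG)
    exact exp_le_exp.2 (mul_le_mul_of_nonneg_right hc hpos)

theorem IsPsiCaputoSolution.norm_le {n : ℕ} {μ : ℝ} (hμ0 : 0 < μ) (hμ1 : μ < 1)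
    {Ψ : ℝ → ℝ} (hΨ : IsPsi Ψ) {A : Matrix (Fin n) (Fin n) ℝ} {η : Fin n → ℝ}
    {g y : ℝ → Fin n → ℝ} (hy : IsPsiCaputoSolution μ Ψ A g η y) {c G a : ℝ} (hc : 0 < c)
    (hG : 0 ≤ G) (ha : 0 ≤ a) (hA : ∀ x, ‖A.mulVec x‖ ≤ a * ‖x‖)
    (hgb : ∀ t, 0 ≤ t → ‖g t‖ ≤ G * exp (c * Ψ t)) (hac : a * c ^ (-μ) ≤ 1 / 2)
    {t : ℝ} (ht : 0 ≤ t) :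
    ‖y t‖ ≤ 2 * (‖η‖ + G * c ^ (-μ)) * exp (c * Ψ t) := by
  have hcont : ContinuousOn (fun s => ‖y s‖ * exp (-(c * Ψ s))) (Icc 0 t) :=
    ((hy.cont.mono Icc_subset_Ici_self).norm).mul
      ((hΨ.continuousOn_Icc le_rfl t).const_mul c).neg.rexp
  obtain ⟨τ, hτ, hmax⟩ := isCompact_Icc.exists_isMaxOn (nonempty_Icc.2 ht) hcont
  -- `Z` is the weighted maximum over `[0, t]`; the integral estimate is applied at its maximizer
  -- `τ`.
  set Z := ‖y τ‖ * exp (-(c * Ψ τ)) with hZ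
  have hZ0 : 0 ≤ Z := by positivity
  have hyZ : ∀ s ∈ Icc 0 t, ‖y s‖ ≤ Z * exp (c * Ψ s) := fun s hs => by
    have h := mul_le_mul_of_nonneg_right (hmax hs) (exp_pos (c * Ψ s)).le
    have e : ‖y s‖ = ‖y s‖ * exp (-(c * Ψ s)) * exp (c * Ψ s) := by
      rw [mul_assoc, ← exp_add, neg_add_cancel, exp_zero, mul_one]
    rw [e]
    exact h
  have hcμ : 0 ≤ c ^ (-μ) := rpow_nonneg hc.le _
  have hE : 1 ≤ exp (c * Ψ τ) := one_le_exp (mul_nonneg hc.le (hΨ.nonneg hτ.1))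
  have key : ‖y τ‖ ≤ (‖η‖ + (a * Z + G) * c ^ (-μ)) * exp (c * Ψ τ) := by
    have hη : ‖η‖ ≤ ‖η‖ * exp (c * Ψ τ) := le_mul_of_one_le_right (norm_nonneg _) hE
    rw [add_mul]
    rcases hτ.1.eq_or_lt with h0 | h0
    · have hyη : ‖y τ‖ = ‖η‖ := by rw [← h0, hy.init]
      rw [hyη]
      exact le_add_of_le_of_nonneg hη (by positivity)
    · have hd : ‖y τ - η‖ ≤ (a * Z + G) * c ^ (-μ) * exp (c * Ψ τ) := by
        refine (pi_norm_le_iff_of_nonneg (by positivity)).2 fun i => ?_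
        rw [← hy.init]
        refine abs_sub_le_of_abs_psiCaputo_le hμ0 hμ1 hΨ h0 (hy.absCont τ h0 i) hc
          (by positivity) fun s hs => ?_
        rw [hy.equation s hs.1 i]
        calc |(A.mulVec (y s) + g s) i| ≤ ‖A.mulVec (y s) + g s‖ :=
            norm_le_pi_norm (A.mulVec (y s) + g s) i
          _ ≤ a * (Z * exp (c * Ψ s)) + G * exp (c * Ψ s) :=
            (norm_add_le _ _).trans (add_le_add ((hA _).trans (mul_le_mul_of_nonneg_left
              (hyZ s ⟨hs.1.le, hs.2.le.trans hτ.2⟩) ha)) (hgb s hs.1.le))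
          _ = _ := by ring
      calc ‖y τ‖ = ‖η + (y τ - η)‖ := by rw [add_sub_cancel]
        _ ≤ _ := (norm_add_le _ _).trans (add_le_add hη hd)
  have hZle : Z ≤ ‖η‖ + (a * Z + G) * c ^ (-μ) := by
    have h := mul_le_mul_of_nonneg_right key (exp_pos (-(c * Ψ τ))).le
    rwa [mul_assoc, ← exp_add, add_neg_cancel, exp_zero, mul_one] at h
  -- Absorption: `a * c ^ (-μ) * Z ≤ Z / 2` moves to the left, whence the factor `2`.
  have hZ2 : Z ≤ 2 * (‖η‖ + G * c ^ (-μ)) := by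
    have := mul_le_mul_of_nonneg_right hac hZ0
    linarith
  exact (hyZ t ⟨ht, le_rfl⟩).trans (mul_le_mul_of_nonneg_right hZ2 (exp_pos _).le)

theorem mainTheorem3 {n : ℕ} (μ : ℝ) (hμ0 : 0 < μ) (hμ1 : μ < 1)
    (Ψ : ℝ → ℝ) (hΨ : IsPsi Ψ)
    (A : Matrix (Fin n) (Fin n) ℝ) (η : Fin n → ℝ) (g : ℝ → Fin n → ℝ)
    (hg : ContinuousOn g (Set.Ici 0)) (hgb : PsiExpBounded Ψ g)
    (y : ℝ → Fin n → ℝ) (hy : IsPsiCaputoSolution μ Ψ A g η y) :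
    PsiExpBounded Ψ y ∧
      PsiExpBounded Ψ (fun t i => psiCaputo 0 μ Ψ (fun s => y s i) t) := by
  obtain ⟨c₀, G, hc₀, hG, hgG⟩ := exists_norm_le_mul_exp_of_psiExpBounded hΨ hg hgb
  set L := LinearMap.toContinuousLinearMap A.mulVecLin
  have hA : ∀ x, ‖A.mulVec x‖ ≤ ‖L‖ * ‖x‖ := fun x => L.le_opNorm x
  have hlim : Filter.Tendsto (fun c : ℝ => ‖L‖ * c ^ (-μ)) Filter.atTop (nhds 0) := by
    simpa using (tendsto_rpow_neg_atTop hμ0).const_mul ‖L‖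
  obtain ⟨c, hcL, hc⟩ :=
    ((hlim.eventually_le_const one_half_pos).and (Filter.eventually_ge_atTop c₀)).exists
  have hc0 : 0 < c := hc₀.trans_le hc
  have hcμ : 0 ≤ c ^ (-μ) := rpow_nonneg hc0.le _
  set M := 2 * (‖η‖ + G * c ^ (-μ))
  have hM : 0 ≤ M := by positivity
  have hyM : ∀ t, 0 ≤ t → ‖y t‖ ≤ M * exp (c * Ψ t) := fun t ht =>
    hy.norm_le hμ0 hμ1 hΨ hc0 hG (norm_nonneg L) hA (hgG c hc) hcL ht
  -- The bounds hold for all `t ≥ 0`, so `T = 1` is arbitrary; the `+ 1` makes the constants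
  -- strictly positive.
  refine ⟨⟨c, hc0, M + 1, 1, by positivity, one_pos, fun t ht => ?_⟩,
    ⟨c, hc0, ‖L‖ * M + G + 1, 1, by positivity, one_pos, fun t ht => ?_⟩⟩
  · exact (hyM t (by linarith)).trans
      (mul_le_mul_of_nonneg_right (by linarith) (exp_pos _).le)
  · have ht0 : 0 < t := by linarith
    have heq : (fun i => psiCaputo 0 μ Ψ (fun s => y s i) t) = A.mulVec (y t) + g t :=
      funext fun i => hy.equation t ht0 i
    simp only [heq]
    calc ‖A.mulVec (y t) + g t‖ ≤ ‖L‖ * (M * exp (c * Ψ t)) + G * exp (c * Ψ t) :=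
          (norm_add_le _ _).trans (add_le_add ((hA _).trans (mul_le_mul_of_nonneg_left
            (hyM t ht0.le) (norm_nonneg L))) (hgG c hc t ht0.le))
      _ ≤ _ := by linarith [exp_pos (c * Ψ t)]
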